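/- An \emph{entourage} on a set $X$ is a reflexive symmetric relation $\varepsilon\subseteq X\times X$; put $B(x,\varepsilon)=\{y:(x,y)\in\varepsilon\}$ and $B(C,\varepsilon)=\bigcup_{c\in C}B(c,\varepsilon)$. A \emph{ballean} is a set $X$ with a family $\mathcal E$ of entourages such that $\bigcup\mathcal E=X\times X$ and for all $\varepsilon,\delta\in\mathcal E$ the composition $\varepsilon\circ\delta$ is contained in some $\eta\in\mathcal E$. Its \emph{coarse structure} ${\downarrow}\mathcal E$ consists of all entourages contained in a member of $\mathcal E$; a \emph{base} of ${\downarrow}\mathcal E$ is a subfamily $\mathcal B\subseteq{\downarrow}\mathcal E$ such that every member of ${\downarrow}\mathcal E$ is contained in a member of $\mathcal B$. The ballean is \emph{cellular} if ${\downarrow}\mathcal E$ has a base consisting of equivalence relations, and \emph{ordinal} if ${\downarrow}\mathcal E$ has a base $\{B_\alpha\}_{\alpha<\kappa}\subseteq\mathcal E$, indexed by an ordinal $\kappa$, with $B_\alpha\subseteq B_\beta$ for $\alpha<\beta<\kappa$. For $A\subseteq X$ let $\mathrm{cov}_\varepsilon(A)=\min\{|C|:C\subseteq X,\ A\subseteq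 B(C,\varepsilon)\}$. Let $\mathrm{cov}^\sharp(X)$ be the smallest cardinal $\kappa$ for which there is $\varepsilon\in\mathcal E$ such that $\sup_{x\in X}\mathrm{cov}_\varepsilon(B(x,\delta))<\kappa$ for every $\delta\in\mathcal E$. Let $\mathrm{cov}^\flat(X)$ be the largest cardinal $\kappa$ such that for every cardinal $\lambda<\kappa$ and every $\varepsilon\in\mathcal E$ there is $\delta\in\mathcal E$ with $\min_{x\in X}\mathrm{cov}_\varepsilon(B(x,\delta))\ge\lambda$. A \emph{multi-map} $\Phi\colon X\multimap X$ is a subset of $X\times X$, with $\Phi(x)=\{y:(x,y)\in\Phi\}$ and $\Phi^{-1}=\{(y,x):(x,y)\in\Phi\}$; for an entourage $\varepsilon$ put $\omega_\Phi(\varepsilon)=\bigcup_{(x,y)\in\varepsilon}\Phi(x)\times\Phi(y)$. $\Phi$ is \emph{coarse} if for every $\varepsilon\in\mathcal E$ there is $\delta\in\mathcal E$ with $\omega_\Phi(\varepsilon)\subseteq\delta$; it is \emph{$\varphi$-coarse}, for a function $\varphi\colon\mathcal E\to\mathcal E$, if $\omega_\Phi(\varepsilon)\subseteq\varphi(\varepsilon)$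 for all $\varepsilon\in\mathcal E$; it is a \emph{coarse equivalence} if $\Phi(X)=X=\Phi^{-1}(X)$ and both $\Phi$ and $\Phi^{-1}$ are coarse. The ballean $X$ is \emph{homogeneous} if there is a function $\varphi\colon\mathcal E\to\mathcal E$ such that for all $x,y\in X$ there is a coarse equivalence $\Phi\colon X\multimap X$ with $y\in\Phi(x)$ such that both $\Phi$ and $\Phi^{-1}$ are $\varphi$-coarse. \textbf{Theorem.} A nonempty cellular ordinal ballean $X$ is homogeneous if and only if $\mathrm{cov}^\flat(X)=\mathrm{cov}^\sharp(X)$. -/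

import Mathlib

universe u v

/-- An entourage on `X` is a reflexive symmetric relation on `X`. -/
structure IsEntourage {X : Type u} (ε : SetRel X X) : Prop where
  refl : ∀ x, (x, x) ∈ ε
  symm : ∀ x y, (x, y) ∈ ε → (y, x) ∈ ε

/-- A cellular entourage is a transitive entourage, i.e. an equivalence relation. -/
structure IsCellularEntourage {X : Type u} (ε : SetRel X X) : Prop extends IsEntourage ε where
  trans : ∀ x y z, (x, y) ∈ ε → (y, z) ∈ ε → (x, z) ∈ ε

/-- A ballean structure on the set `X`: a family `radii` of entourages that covers `X × X` and
such that the composition of any two members is contained in a third. -/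
structure Ballean (X : Type u) where
  radii : Set (SetRel X X)
  isEntourage : ∀ ε ∈ radii, IsEntourage ε
  sUnion_radii : ⋃₀ radii = Set.univ
  comp_subset : ∀ ε ∈ radii, ∀ δ ∈ radii, ∃ η ∈ radii, SetRel.comp ε δ ⊆ η

namespace Ballean

variable {X : Type u} {Y : Type v}

/-- The coarse structure generated by the ballean: all subentourages of the radii. -/
def coarseStructure (𝓔 : Ballean X) : Set (SetRel X X) :=
  {δ | IsEntourage δ ∧ ∃ ε ∈ 𝓔.radii, δ ⊆ ε}

/-- `𝓑` is a base of the coarse structure of the ballean. -/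
def IsBase (𝓔 : Ballean X) (𝓑 : Set (SetRel X X)) : Prop :=
  𝓑 ⊆ 𝓔.coarseStructure ∧ ∀ ε ∈ 𝓔.coarseStructure, ∃ β ∈ 𝓑, ε ⊆ β

/-- A ballean is ordinal if its coarse structure has a well-ordered base consisting of radii:
a base `{B α}` indexed by the ordinals `α < κ` with `B α ⊆ B β` whenever `α ≤ β`. -/
def IsOrdinal (𝓔 : Ballean X) : Prop :=
  ∃ (κ : Ordinal.{u}) (B : Set.Iio κ → SetRel X X),
    Monotone B ∧ Set.range B ⊆ 𝓔.radii ∧ 𝓔.IsBase (Set.range B)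

/-- A ballean is cellular if its coarse structure has a base of equivalence relations. -/
def IsCellular (𝓔 : Ballean X) : Prop :=
  ∃ 𝓑 : Set (SetRel X X), 𝓔.IsBase 𝓑 ∧ ∀ ε ∈ 𝓑, IsCellularEntourage ε

/-- The ball `B(x, ε)`. -/
def ball (x : X) (ε : SetRel X X) : Set X := {y | (x, y) ∈ ε}

/-- The `ε`-neighbourhood `B(A, ε)` of a set `A`. -/
def nhd (A : Set X) (ε : SetRel X X) : Set X := ⋃ a ∈ A, ball a ε

/-- The smallest number of `ε`-balls covering the set `A`. -/
noncomputable def cov (ε : SetRel X X) (A : Set X) : Cardinal.{u} :=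
  sInf {c | ∃ C : Set X, A ⊆ nhd C ε ∧ c = Cardinal.mk C}

/-- The cardinals `κ` for which some radius `ε` satisfies `sup_x cov_ε(B(x, δ)) < κ` for all
radii `δ`. -/
def IsSharpBound (𝓔 : Ballean X) (κ : Cardinal.{u}) : Prop :=
  ∃ ε ∈ 𝓔.radii, ∀ δ ∈ 𝓔.radii, (⨆ x : X, cov ε (ball x δ)) < κ

/-- The cardinals `κ` such that for any `l < κ` and any radius `ε` there is a radius `δ` with
`min_x cov_ε(B(x, δ)) ≥ l`. -/
def IsFlatBound (𝓔 : Ballean X) (κ : Cardinal.{u}) : Prop :=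
  ∀ l < κ, ∀ ε ∈ 𝓔.radii, ∃ δ ∈ 𝓔.radii, ∀ x : X, l ≤ cov ε (ball x δ)

/-- The sharp covering number: the smallest cardinal `κ` with `IsSharpBound`. -/
noncomputable def covSharp (𝓔 : Ballean X) : Cardinal.{u} := sInf {κ | 𝓔.IsSharpBound κ}

/-- The flat covering number: the largest cardinal `κ` with `IsFlatBound`. -/
noncomputable def covFlat (𝓔 : Ballean X) : Cardinal.{u} := sSup {κ | 𝓔.IsFlatBound κ}

/-- The `ε`-oscillation `⋃_{(x, y) ∈ ε} Φ(x) × Φ(y)` of the multi-map `Φ : X ⊸ Y`. -/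
def oscillation (Φ : SetRel X Y) (ε : SetRel X X) : SetRel Y Y :=
  {p | ∃ x y, (x, y) ∈ ε ∧ (x, p.1) ∈ Φ ∧ (y, p.2) ∈ Φ}

/-- Coarse multi-maps. -/
def IsCoarse (𝓔 : Ballean X) (𝓕 : Ballean Y) (Φ : SetRel X Y) : Prop :=
  ∀ ε ∈ 𝓔.radii, ∃ δ ∈ 𝓕.radii, oscillation Φ ε ⊆ δ

/-- `φ`-coarse multi-maps, for a function `φ` between the sets of radii. -/
def IsCoarseWith (𝓔 : Ballean X) (𝓕 : Ballean Y) (φ : 𝓔.radii → 𝓕.radii)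
    (Φ : SetRel X Y) : Prop :=
  ∀ ε : 𝓔.radii, oscillation Φ (ε : SetRel X X) ⊆ (φ ε : SetRel Y Y)

/-- A coarse equivalence is a multi-map `Φ : X ⊸ Y` with `Φ⁻¹(Y) = X` and `Φ(X) = Y` such that
`Φ` and `Φ⁻¹` are coarse. -/
structure IsCoarseEquivalence (𝓔 : Ballean X) (𝓕 : Ballean Y) (Φ : SetRel X Y) : Prop where
  dom_eq : Φ.dom = Set.univ
  cod_eq : Φ.cod = Set.univ
  coarse : IsCoarse 𝓔 𝓕 Φ
  coarse_inv : IsCoarse 𝓕 𝓔 Φ.inv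

/-- Homogeneous balleans. -/
def IsHomogeneous (𝓔 : Ballean X) : Prop :=
  ∃ φ : 𝓔.radii → 𝓔.radii, ∀ x y : X, ∃ Φ : SetRel X X,
    IsCoarseEquivalence 𝓔 𝓔 Φ ∧ (x, y) ∈ Φ ∧
      IsCoarseWith 𝓔 𝓔 φ Φ ∧ IsCoarseWith 𝓔 𝓔 φ Φ.inv

/-! On a nonempty set both covering numbers are attained, so that they are indeed the smallest and
the largest cardinal with the defining property. -/

theorem radii_nonempty [Nonempty X] (𝓔 : Ballean X) : 𝓔.radii.Nonempty := by
  obtain ⟨x⟩ := ‹Nonempty X›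
  have h : (x, x) ∈ ⋃₀ 𝓔.radii := by rw [𝓔.sUnion_radii]; trivial
  obtain ⟨ε, hε, -⟩ := h
  exact ⟨ε, hε⟩

theorem cov_le_mk {ε : SetRel X X} (hε : IsEntourage ε) (A : Set X) :
    cov ε A ≤ Cardinal.mk X := by
  have h : cov ε A ≤ Cardinal.mk A :=
    csInf_le' ⟨A, fun a ha => Set.mem_biUnion ha (hε.refl a), rfl⟩
  exact h.trans (Cardinal.mk_set_le A)

theorem isLeast_covSharp [Nonempty X] (𝓔 : Ballean X) :
    IsLeast {κ | 𝓔.IsSharpBound κ} 𝓔.covSharp := by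
  obtain ⟨ε, hε⟩ := 𝓔.radii_nonempty
  have hne : {κ | 𝓔.IsSharpBound κ}.Nonempty :=
    ⟨Order.succ (Cardinal.mk X), ε, hε, fun δ _ => Order.lt_succ_of_le
      (ciSup_le' fun x => cov_le_mk (𝓔.isEntourage ε hε) _)⟩
  exact ⟨csInf_mem hne, fun κ hκ => csInf_le' hκ⟩

theorem isGreatest_covFlat [Nonempty X] (𝓔 : Ballean X) :
    IsGreatest {κ | 𝓔.IsFlatBound κ} 𝓔.covFlat := by
  have hbdd : BddAbove {κ | 𝓔.IsFlatBound κ} := by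
    refine ⟨Order.succ (Cardinal.mk X), fun κ hκ => ?_⟩
    by_contra! hlt
    obtain ⟨ε, hε⟩ := 𝓔.radii_nonempty
    obtain ⟨x⟩ := ‹Nonempty X›
    obtain ⟨δ, -, hδ⟩ := hκ _ hlt ε hε
    exact absurd ((hδ x).trans (cov_le_mk (𝓔.isEntourage ε hε) _))
      (not_le.2 (Order.lt_succ _))
  refine ⟨fun l hl => ?_, fun κ hκ => le_csSup hbdd hκ⟩
  obtain ⟨κ, hκ, hlκ⟩ := exists_lt_of_lt_csSup' hl
  exact hκ l hlκ

end Ballean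

-- If `X` is homogeneous, pulling covers back along the coarse equivalences taking `x` to `y`
-- compares covering numbers of balls at `x` with those at `y`, with a control `φ` independent of
-- the points. Every `l` below `covSharp` is therefore a lower bound at all points at once
-- (`cov_ball_le_of_coarse`).
--
-- For the converse, cellularity replaces entourages by equivalence relations and covering numbers
-- by counts of classes. The aim is a well-ordered cofinal tower of bounded relations `E i` over
-- some `E₀` in which all `E i`-classes split into the same number of classes of the union of the
-- earlier relations. Such a tower gives points coordinates of finite support, determined up to
-- `E₀`, with `E i` expressing equality of all coordinates above `i`. Swapping the values of `x` and
-- `y` in each coordinate is then a coarse equivalence with uniform control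
-- (`isHomogeneous_of_tower`).
--
-- The tower is built according to the common value `κ` of the covering numbers. If `κ ≤ 2` the
-- ballean is bounded, and `2 < κ < ℵ₀` is impossible because class counts bounded below by 2 at
-- each stage add up. If `κ > ℵ₀`, each relation is adjusted by infinite cardinal arithmetic
-- (`exists_setoid_classCount_eq`). If `κ = ℵ₀`, the coarse structure has a countable base, but
-- finite counts need not divide evenly. Each class is therefore kept divisible into either `label`
-- or `label + 1` parts; this freedom makes all blocks of the next level have equal weight
-- (`Finset.exists_exact_blocks`). The choices depend on the level above, so they are made by a
-- descending recursion anchored at the classes of a base point (`exists_consistent_flags`).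

universe w

namespace Ballean
variable {X : Type u}

/-- The number of `r`-classes meeting the `s`-class of `x`. -/
noncomputable def classCount (r s : Setoid X) (x : X) : Cardinal.{u} :=
  Cardinal.mk (Quotient.mk r '' {y | s x y})

/-- A setoid is bounded if it is contained in a radius of the ballean. -/
def IsBoundedSetoid (𝓔 : Ballean X) (s : Setoid X) : Prop :=
  ∃ η ∈ 𝓔.radii, ∀ x y, s x y → (x, y) ∈ η

/-! ### Coordinates from a regular tower of equivalence relations. -/

/-- A union of a chain of equivalence relations is already transitive, so no further generation is
needed. -/
theorem sup_iSup_apply_iff {ι : Type w} [LinearOrder ι] {E₀ : Setoid X} {E : ι → Setoid X}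
    (hmono : Monotone E) (h₀ : ∀ i, E₀ ≤ E i) (i : ι) (x y : X) :
    (E₀ ⊔ ⨆ j < i, E j) x y ↔ E₀ x y ∨ ∃ j < i, E j x y := by
  constructor
  · let T : Setoid X :=
      { r := fun x y => E₀ x y ∨ ∃ j < i, E j x y
        iseqv :=
          { refl := fun x => Or.inl (E₀.refl x)
            symm := by
              rintro x y (h | ⟨j, hj, h⟩)
              · exact Or.inl (E₀.symm h)
              · exact Or.inr ⟨j, hj, (E j).symm h⟩
            trans := by
              rintro x y z (h | ⟨j, hj, h⟩) (h' | ⟨j', hj', h'⟩)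
              · exact Or.inl (E₀.trans h h')
              · exact Or.inr ⟨j', hj', (E j').trans (h₀ j' h) h'⟩
              · exact Or.inr ⟨j, hj, (E j).trans h (h₀ j h')⟩
              · exact Or.inr ⟨max j j', max_lt hj hj', (E _).trans
                  (hmono (le_max_left j j') h) (hmono (le_max_right j j') h')⟩ } }
    have hT : E₀ ⊔ ⨆ j < i, E j ≤ T :=
      sup_le (fun _ _ h => Or.inl h) (iSup₂_le fun j hj _ _ h => Or.inr ⟨j, hj, h⟩)
    exact fun h => hT h
  · rintro (h | ⟨j, hj, h⟩)
    · exact (le_sup_left : E₀ ≤ E₀ ⊔ ⨆ j < i, E j) h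
    · exact ((le_iSup₂ (f := fun j (_ : j < i) => E j) j hj).trans le_sup_right) h

/-- This supplies one coordinate: the `P`-classes in each `E`-class are numbered by a common set.
Giving the least point of every `E`-class the default label `g₀` is what later forces supports to be
finite. -/
theorem exists_labelling [Nonempty X] [LinearOrder X] [WellFoundedLT X] {P E : Setoid X}
    (hPE : P ≤ E) {c : Cardinal.{u}} (hc : ∀ x, classCount P E x = c) :
    ∃ (G : Type u) (f : X → G) (g₀ : G), (∀ x y, P x y → f x = f y) ∧
      (∀ x y, E x y → f x = f y → P x y) ∧ (∀ x g, ∃ y, E x y ∧ f y = g) ∧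
      ∀ x, (∀ y, E x y → x ≤ y) → f x = g₀ := by
  classical
  obtain ⟨x₀⟩ := ‹Nonempty X›
  let A : Quotient E → Set (Quotient P) := fun q => Quotient.mk P '' {y | Quotient.mk E y = q}
  have hA : ∀ x, A (Quotient.mk E x) = Quotient.mk P '' {y | E x y} := by
    intro x
    simp only [A]
    congr 1
    ext y
    exact ⟨fun h => E.symm (Quotient.exact h), fun h => Quotient.sound (E.symm h)⟩
  have hcard : ∀ q, Nonempty (A q ≃ c.out) := by
    intro q
    induction q using Quotient.inductionOn with | _ x =>
    rw [← Cardinal.eq, Cardinal.mk_out, hA]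
    exact hc x
  have hleast : ∀ q : Quotient E, ∃ b, Quotient.mk E b = q ∧
      ∀ y, Quotient.mk E y = q → b ≤ y := by
    intro q
    have hne : {y | Quotient.mk E y = q}.Nonempty := Quotient.exists_rep q
    exact ⟨WellFounded.min (wellFounded_lt (α := X)) _ hne,
      WellFounded.min_mem wellFounded_lt _ hne,
      fun y hy => WellFounded.min_le wellFounded_lt (s := {y | Quotient.mk E y = q}) hy⟩
  choose b hb hbmin using hleast
  let e₀ : ∀ q, A q ≃ c.out := fun q => (hcard q).some
  let B : ∀ q, A q := fun q => ⟨Quotient.mk P (b q), b q, hb q, rfl⟩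
  let g₀ : c.out := e₀ (Quotient.mk E x₀) (B _)
  -- A transposition normalises each numbering so that the class of the least point receives `g₀`.
  let e : ∀ q, A q ≃ c.out := fun q => (e₀ q).trans (Equiv.swap (e₀ q (B q)) g₀)
  have he : ∀ q, e q (B q) = g₀ := fun q => by simp [e]
  let f : X → c.out := fun x => e (Quotient.mk E x) ⟨Quotient.mk P x, x, rfl, rfl⟩
  have hf : ∀ q x (hx : Quotient.mk E x = q), f x = e q ⟨Quotient.mk P x, x, hx, rfl⟩ := by
    rintro q x rfl
    rfl
  refine ⟨c.out, f, g₀, fun x y h => ?_, fun x y h hxy => ?_, fun x g => ?_, fun x hx => ?_⟩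
  · have hE : Quotient.mk E y = Quotient.mk E x := (Quotient.sound (hPE h)).symm
    rw [hf _ x rfl, hf _ y hE]
    congr 2
    exact Quotient.sound h
  · have hE : Quotient.mk E y = Quotient.mk E x := (Quotient.sound h).symm
    rw [hf _ x rfl, hf _ y hE] at hxy
    exact Quotient.exact (congrArg Subtype.val ((e _).injective hxy))
  · obtain ⟨⟨p, y, hy, rfl⟩, hp⟩ := (e (Quotient.mk E x)).surjective g
    refine ⟨y, E.symm (Quotient.exact hy), ?_⟩
    rw [hf _ y hy, hp]
  · have hbx : b (Quotient.mk E x) = x :=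
      le_antisymm (hbmin _ x rfl) (hx _ (E.symm (Quotient.exact (hb _))))
    rw [hf _ x rfl, ← he (Quotient.mk E x)]
    congr 2
    rw [hbx]

/-- The coordinates identify the `E₀`-classes with all finitely supported families of labels. A
coordinatewise permutation preserves agreement above `i`, so it respects each `E i`, and its control
does not depend on the points exchanged. -/
theorem isHomogeneous_of_tower [Nonempty X] (𝓔 : Ballean X) {ι : Type w} [LinearOrder ι]
    [WellFoundedLT ι] {E₀ : Setoid X} {E : ι → Setoid X} (hmono : Monotone E)
    (h₀ : ∀ i, E₀ ≤ E i) (hbdd : ∀ i, 𝓔.IsBoundedSetoid (E i))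
    (hcof : ∀ ε ∈ 𝓔.radii, ∃ i, ∀ x y, (x, y) ∈ ε → E i x y)
    (hreg : ∀ i, ∃ c, ∀ x, classCount (E₀ ⊔ ⨆ j < i, E j) (E i) x = c) :
    𝓔.IsHomogeneous := by
  classical
  obtain ⟨_, _⟩ := exists_wellFoundedLT X
  have hP := sup_iSup_apply_iff hmono h₀
  have hPE : ∀ i, (E₀ ⊔ ⨆ j < i, E j) ≤ E i := fun i =>
    sup_le (h₀ i) (iSup₂_le fun j hj => hmono hj.le)
  choose card hcard using hreg
  choose G c g₀ hcP hcE hcs hcl using fun i => exists_labelling (hPE i) (hcard i)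
  have heq : ∀ i j x y, i < j → E i x y → c j x = c j y := fun i j x y hij h =>
    hcP j x y ((hP j x y).2 (Or.inr ⟨i, hij, h⟩))
  have hcover : ∀ x y, ∃ i, E i x y := by
    intro x y
    have hxy : (x, y) ∈ ⋃₀ 𝓔.radii := by rw [𝓔.sUnion_radii]; trivial
    obtain ⟨ε, hε, h⟩ := hxy
    obtain ⟨i, hi⟩ := hcof ε hε
    exact ⟨i, hi x y h⟩
  have hrel : ∀ i x y, (∀ j, i < j → c j x = c j y) → E i x y := by
    intro i x y h
    have hne : {j | E j x y}.Nonempty := hcover x y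
    set k := WellFounded.min wellFounded_lt _ hne
    have hk : E k x y := WellFounded.min_mem wellFounded_lt _ hne
    rcases le_or_gt k i with hki | hik
    · exact hmono hki hk
    · rcases (hP k x y).1 (hcE k x y hk (h k hik)) with h' | ⟨j, hj, h'⟩
      · exact h₀ i h'
      · exact absurd hj (not_lt.2 (WellFounded.min_le wellFounded_lt (s := {j | E j x y}) h'))
  -- At the least index `k` of the support, `x` is not least in its `E k`-class. A smaller point of
  -- that class has the same coordinates above `k`, so induction along the well-order of `X`
  -- applies.
  have hsupp : ∀ x, {i | c i x ≠ g₀ i}.Finite := by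
    intro x
    induction x using WellFoundedLT.induction with | _ x ih =>
    rcases Set.eq_empty_or_nonempty {i | c i x ≠ g₀ i} with he | hne
    · rw [he]
      exact Set.finite_empty
    · set k := WellFounded.min wellFounded_lt _ hne
      have hk : c k x ≠ g₀ k := WellFounded.min_mem wellFounded_lt _ hne
      obtain ⟨y, hy, hyx⟩ : ∃ y, E k x y ∧ y < x := by
        by_contra! hcon
        exact hk (hcl k x hcon)
      refine ((ih y hyx).insert k).subset fun j hj => ?_
      rcases (WellFounded.min_le wellFounded_lt hj : k ≤ j).eq_or_lt with h | h
      · exact Or.inl h.symm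
      · refine Or.inr ?_
        rw [Set.mem_ofPred_eq, ← heq k j x y h hy]
        exact hj
  -- Coordinates are prescribed from the top index down. Moving inside an `E a`-class corrects
  -- coordinate `a` without changing the higher ones; passing to the least point of the class of `⨆
  -- j < a, E j` (with `E₀`) then resets all coordinates below `a` to their defaults.
  have hsurj : ∀ (s : Finset ι) (f : ∀ i, G i), (∀ i, i ∉ s → f i = g₀ i) →
      ∃ x, ∀ i, c i x = f i := by
    intro s
    induction s using Finset.induction_on_min with
    | empty =>
      intro f hf
      refine ⟨WellFounded.min (wellFounded_lt (α := X)) Set.univ Set.univ_nonempty, fun i => ?_⟩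
      rw [hf i (by simp)]
      exact hcl i _ fun y _ => WellFounded.min_le wellFounded_lt (Set.mem_univ y)
    | insert a s ha ih =>
      intro f hf
      obtain ⟨u, hu⟩ := ih (fun i => if i = a then g₀ i else f i) fun i hi => by
        by_cases hia : i = a
        · simp [hia]
        · simpa [hia] using hf i (by simp [hia, hi])
      obtain ⟨v, huv, hv⟩ := hcs a u (f a)
      have hne : {z | (E₀ ⊔ ⨆ j < a, E j) v z}.Nonempty := ⟨v, (E₀ ⊔ ⨆ j < a, E j).refl v⟩
      set z := WellFounded.min wellFounded_lt _ hne
      have hz : (E₀ ⊔ ⨆ j < a, E j) v z := WellFounded.min_mem wellFounded_lt _ hne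
      refine ⟨z, fun i => ?_⟩
      rcases lt_trichotomy i a with h | h | h
      · rw [hf i]
        · refine hcl i z fun y hy => WellFounded.min_le wellFounded_lt ?_
          exact Setoid.trans' _ hz ((hP a z y).2 (Or.inr ⟨i, h, hy⟩))
        · simp only [Finset.mem_insert, not_or]
          exact ⟨h.ne, fun hi => (ha i hi).not_gt h⟩
      · subst h
        rw [← hv]
        exact (hcP i v z hz).symm
      · have h1 := heq a i u z h (Setoid.trans' _ huv (hPE a hz))
        rw [← h1, hu i, if_neg h.ne']
  have hmove : ∀ x y u, ∃ v, ∀ i, c i v = Equiv.swap (c i x) (c i y) (c i u) := by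
    intro x y u
    -- Outside the three supports the swap is trivial, so the target family is finitely supported.
    refine hsurj (((hsupp x).union (hsupp y)).union (hsupp u)).toFinset _ fun i hi => ?_
    simp only [Set.Finite.mem_toFinset, Set.mem_union, Set.mem_ofPred_eq, not_or, not_not] at hi
    rw [hi.1.1, hi.1.2, hi.2]
    simp
  choose ind hind using hcof
  choose η hη hEη using hbdd
  let φ : 𝓔.radii → 𝓔.radii := fun ε => ⟨η (ind ε ε.2), hη _⟩
  refine ⟨φ, fun x y => ?_⟩
  let Φ : SetRel X X := {p | ∀ i, c i p.2 = Equiv.swap (c i x) (c i y) (c i p.1)}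
  have h1 : IsCoarseWith 𝓔 𝓔 φ Φ := by
    rintro ε ⟨v, v'⟩ ⟨u, u', huu, hv, hv'⟩
    refine hEη _ _ _ (hrel _ _ _ fun j hj => ?_)
    rw [hv j, hv' j]
    dsimp only
    rw [heq _ j u u' hj (hind ε ε.2 u u' huu)]
  have h2 : IsCoarseWith 𝓔 𝓔 φ Φ.inv := by
    rintro ε ⟨v, v'⟩ ⟨u, u', huu, hv, hv'⟩
    refine hEη _ _ _ (hrel _ _ _ fun j hj => ?_)
    have hv₁ : c j u = Equiv.swap (c j x) (c j y) (c j v) := hv j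
    have hv₂ : c j u' = Equiv.swap (c j x) (c j y) (c j v') := hv' j
    have h := heq _ j u u' hj (hind ε ε.2 u u' huu)
    rw [hv₁, hv₂] at h
    exact (Equiv.swap _ _).injective h
  refine ⟨Φ, ⟨?_, ?_, fun ε hε => ⟨_, (φ ⟨ε, hε⟩).2, h1 ⟨ε, hε⟩⟩,
    fun ε hε => ⟨_, (φ ⟨ε, hε⟩).2, h2 ⟨ε, hε⟩⟩⟩, fun i => by simp, h1, h2⟩
  · refine Set.eq_univ_of_forall fun u => ?_
    obtain ⟨v, hv⟩ := hmove x y u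
    exact ⟨v, hv⟩
  · refine Set.eq_univ_of_forall fun v => ?_
    obtain ⟨u, hu⟩ := hmove x y v
    refine ⟨u, fun i => ?_⟩
    simp [hu i]

/-! ### Class counts, covering numbers, and necessity of the equality. -/

theorem mk_quotient_image_le {r r' : Setoid X} (h : r ≤ r') (A : Set X) :
    Cardinal.mk (Quotient.mk r' '' A) ≤ Cardinal.mk (Quotient.mk r '' A) := by
  have : Quotient.mk r' '' A =
      Quotient.map' (s₁ := r) (s₂ := r') id h '' (Quotient.mk r '' A) := by
    rw [Set.image_image]
    rfl
  rw [this]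
  exact Cardinal.mk_image_le

theorem classCount_anti {r r' : Setoid X} (h : r ≤ r') (s : Setoid X) (x : X) :
    classCount r' s x ≤ classCount r s x :=
  mk_quotient_image_le h _

theorem classCount_mono (r : Setoid X) {s s' : Setoid X} (h : s ≤ s') (x : X) :
    classCount r s x ≤ classCount r s' x :=
  Cardinal.mk_le_mk_of_subset (Set.image_mono fun _ hy => h hy)

theorem mk_quotient_image_ker {Z : Type u} (f : X → Z) (A : Set X) :
    Cardinal.mk (Quotient.mk (Setoid.ker f) '' A) = Cardinal.mk (f '' A) := by
  let g : Quotient (Setoid.ker f) → Z := Quotient.lift f fun _ _ h => h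
  have hg : Function.Injective g := by
    rintro ⟨a⟩ ⟨b⟩ h
    exact Quotient.sound h
  have : f '' A = g '' (Quotient.mk (Setoid.ker f) '' A) := by
    rw [Set.image_image]
    rfl
  rw [this, Cardinal.mk_image_eq hg]

theorem cov_le_of_subset_nhd {ε : SetRel X X} {A C : Set X} (h : A ⊆ nhd C ε) :
    cov ε A ≤ Cardinal.mk C :=
  csInf_le' ⟨C, h, rfl⟩

theorem exists_cov_eq {ε : SetRel X X} (hε : IsEntourage ε) (A : Set X) :
    ∃ C : Set X, A ⊆ nhd C ε ∧ cov ε A = Cardinal.mk C :=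
  csInf_mem (s := {c | ∃ C : Set X, A ⊆ nhd C ε ∧ c = Cardinal.mk C})
    ⟨_, A, fun a ha => Set.mem_biUnion ha (hε.refl a), rfl⟩

theorem mk_quotient_image_le_cov {ε : SetRel X X} (hε : IsEntourage ε) {s : Setoid X}
    (h : ∀ x y, (x, y) ∈ ε → s x y) (A : Set X) :
    Cardinal.mk (Quotient.mk s '' A) ≤ cov ε A := by
  obtain ⟨C, hC, hcov⟩ := exists_cov_eq hε A
  rw [hcov]
  refine (Cardinal.mk_le_mk_of_subset ?_).trans (Cardinal.mk_image_le (f := Quotient.mk s))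
  rintro _ ⟨a, ha, rfl⟩
  obtain ⟨c, hc, hca⟩ := Set.mem_iUnion₂.1 (hC ha)
  exact ⟨c, hc, Quotient.sound (h c a hca)⟩

theorem cov_le_mk_quotient_image {ε : SetRel X X} {s : Setoid X}
    (h : ∀ x y, s x y → (x, y) ∈ ε) (A : Set X) :
    cov ε A ≤ Cardinal.mk (Quotient.mk s '' A) := by
  refine (cov_le_of_subset_nhd (C := Quotient.out '' (Quotient.mk s '' A)) fun a ha => ?_).trans
    Cardinal.mk_image_le
  refine Set.mem_biUnion (Set.mem_image_of_mem _ (Set.mem_image_of_mem _ ha)) (h _ _ ?_)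
  exact Quotient.mk_out (s := s) a

theorem covFlat_le_covSharp [Nonempty X] (𝓔 : Ballean X) : 𝓔.covFlat ≤ 𝓔.covSharp := by
  by_contra! hlt
  obtain ⟨ε, hε, hsup⟩ := 𝓔.isLeast_covSharp.1
  obtain ⟨δ, hδ, hle⟩ := 𝓔.isGreatest_covFlat.1 _ hlt ε hε
  obtain ⟨x⟩ := ‹Nonempty X›
  exact absurd ((hle x).trans (le_ciSup Cardinal.bddAbove_of_small x)) (not_le.2 (hsup δ hδ))

/-- `Φ` sends the ball at `x` into the `φ δ`-ball at `y`; choosing preimages of the centres of an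
`ε`-cover there gives centres of a `φ ε`-cover of the original ball. -/
theorem cov_ball_le_of_coarse {𝓔 : Ballean X} {φ : 𝓔.radii → 𝓔.radii} {Φ : SetRel X X}
    (hΦ : IsCoarseEquivalence 𝓔 𝓔 Φ) (h : IsCoarseWith 𝓔 𝓔 φ Φ)
    (hinv : IsCoarseWith 𝓔 𝓔 φ Φ.inv) {x y : X} (hxy : (x, y) ∈ Φ) (ε δ : 𝓔.radii) :
    cov (φ ε : SetRel X X) (ball x δ) ≤ cov (ε : SetRel X X) (ball y (φ δ)) := by
  obtain ⟨C, hC, hcov⟩ := exists_cov_eq (𝓔.isEntourage _ ε.2) (ball y (φ δ : SetRel X X))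
  have hcod : ∀ c, ∃ c', (c', c) ∈ Φ := fun c => by
    have : c ∈ Φ.cod := by rw [hΦ.cod_eq]; trivial
    exact this
  choose g hg using hcod
  rw [hcov]
  refine (cov_le_of_subset_nhd (C := g '' C) fun z hz => ?_).trans Cardinal.mk_image_le
  have hz' : z ∈ Φ.dom := by rw [hΦ.dom_eq]; trivial
  obtain ⟨w, hw⟩ := hz'
  have hyw : w ∈ ball y (φ δ : SetRel X X) := h δ ⟨x, z, hz, hxy, hw⟩
  obtain ⟨c, hc, hcw⟩ := Set.mem_iUnion₂.1 (hC hyw)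
  exact Set.mem_biUnion (Set.mem_image_of_mem g hc) (hinv ε ⟨c, w, hcw, hg c, hw⟩)

theorem IsHomogeneous.covFlat_eq_covSharp [Nonempty X] {𝓔 : Ballean X} (h : 𝓔.IsHomogeneous) :
    𝓔.covFlat = 𝓔.covSharp := by
  refine le_antisymm 𝓔.covFlat_le_covSharp (𝓔.isGreatest_covFlat.2 fun l hl ε hε => ?_)
  obtain ⟨φ, hφ⟩ := h
  -- Minimality of `covSharp` is applied at the radius `φ ε`, since transport turns `φ ε`-covering
  -- numbers at any `x` into `ε`-covering numbers at `y`.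
  have hl' : ¬ 𝓔.IsSharpBound l := fun hb => not_le.2 hl (𝓔.isLeast_covSharp.2 hb)
  simp only [IsSharpBound, not_exists, not_and, not_forall, not_lt] at hl'
  obtain ⟨δ, hδ, hsup⟩ := hl' (φ ⟨ε, hε⟩) (φ ⟨ε, hε⟩).2
  refine ⟨φ ⟨δ, hδ⟩, (φ ⟨δ, hδ⟩).2, fun y => hsup.trans (ciSup_le' fun x => ?_)⟩
  obtain ⟨Φ, hΦ, hxy, h₁, h₂⟩ := hφ x y
  exact cov_ball_le_of_coarse hΦ h₁ h₂ hxy ⟨ε, hε⟩ ⟨δ, hδ⟩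

theorem isHomogeneous_of_univ_mem [Nonempty X] {𝓔 : Ballean X} (h : Set.univ ∈ 𝓔.radii) :
    𝓔.IsHomogeneous := by
  have huniv : ∀ Φ : SetRel X X, IsCoarseWith 𝓔 𝓔 (fun _ => ⟨Set.univ, h⟩) Φ :=
    fun Φ ε p _ => trivial
  refine ⟨fun _ => ⟨Set.univ, h⟩, fun x y => ⟨Set.univ, ⟨?_, ?_, fun ε _ => ⟨_, h, fun _ _ =>
    trivial⟩, fun ε _ => ⟨_, h, fun _ _ => trivial⟩⟩, trivial, huniv _, huniv _⟩⟩
  · exact Set.eq_univ_of_forall fun u => ⟨u, trivial⟩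
  · exact Set.eq_univ_of_forall fun u => ⟨u, trivial⟩

/-! ### Bounded equivalence relations in cellular ordinal balleans. -/

theorem IsBoundedSetoid.of_le {𝓔 : Ballean X} {r s : Setoid X} (hs : 𝓔.IsBoundedSetoid s)
    (h : r ≤ s) : 𝓔.IsBoundedSetoid r := by
  obtain ⟨η, hη, hsη⟩ := hs
  exact ⟨η, hη, fun x y hxy => hsη x y (h hxy)⟩

theorem IsCellular.exists_isBoundedSetoid {𝓔 : Ballean X} (hcell : 𝓔.IsCellular)
    {ε : SetRel X X} (hε : ε ∈ 𝓔.radii) :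
    ∃ s, 𝓔.IsBoundedSetoid s ∧ ∀ x y, (x, y) ∈ ε → s x y := by
  obtain ⟨𝓑, ⟨hsub, hbase⟩, hcel⟩ := hcell
  obtain ⟨β, hβ, hεβ⟩ := hbase ε ⟨𝓔.isEntourage ε hε, ε, hε, subset_rfl⟩
  obtain ⟨-, η, hη, hβη⟩ := hsub hβ
  have hc := hcel β hβ
  exact ⟨⟨fun x y => (x, y) ∈ β, hc.refl, @hc.symm, @hc.trans⟩, ⟨η, hη, fun x y h => hβη h⟩,
    fun x y h => hεβ h⟩

theorem IsCellular.isBoundedSetoid_sup {𝓔 : Ballean X} (hcell : 𝓔.IsCellular) {r s : Setoid X}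
    (hr : 𝓔.IsBoundedSetoid r) (hs : 𝓔.IsBoundedSetoid s) : 𝓔.IsBoundedSetoid (r ⊔ s) := by
  obtain ⟨ε, hε, hrε⟩ := hr
  obtain ⟨δ, hδ, hsδ⟩ := hs
  obtain ⟨η, hη, hsub⟩ := 𝓔.comp_subset ε hε δ hδ
  obtain ⟨t, ht, hηt⟩ := hcell.exists_isBoundedSetoid hη
  refine ht.of_le (sup_le (fun x y h => hηt x y (hsub ⟨y, hrε x y h, ?_⟩))
    fun x y h => hηt x y (hsub ⟨x, ?_, hsδ x y h⟩))
  · exact (𝓔.isEntourage δ hδ).refl y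
  · exact (𝓔.isEntourage ε hε).refl x

theorem exists_setoid_sharp [Nonempty X] {𝓔 : Ballean X} (hcell : 𝓔.IsCellular) {κ : Cardinal.{u}}
    (hκ : 𝓔.IsSharpBound κ) :
    ∃ s₀, 𝓔.IsBoundedSetoid s₀ ∧ ∀ s, 𝓔.IsBoundedSetoid s →
      ∃ μ < κ, ∀ x, classCount s₀ s x ≤ μ := by
  obtain ⟨ε, hε, hsup⟩ := hκ
  obtain ⟨s₀, hs₀, hεs₀⟩ := hcell.exists_isBoundedSetoid hε
  refine ⟨s₀, hs₀, fun s ⟨δ, hδ, hsδ⟩ => ⟨_, hsup δ hδ, fun x => ?_⟩⟩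
  calc classCount s₀ s x ≤ Cardinal.mk (Quotient.mk s₀ '' ball x δ) :=
        Cardinal.mk_le_mk_of_subset (Set.image_mono fun y hy => hsδ x y hy)
    _ ≤ cov ε (ball x δ) := mk_quotient_image_le_cov (𝓔.isEntourage ε hε) hεs₀ _
    _ ≤ _ := le_ciSup (f := fun x => cov ε (ball x δ)) Cardinal.bddAbove_of_small x

theorem exists_setoid_flat {𝓔 : Ballean X} (hcell : 𝓔.IsCellular) {κ : Cardinal.{u}}
    (hκ : 𝓔.IsFlatBound κ) {l : Cardinal.{u}} (hl : l < κ) {r : Setoid X}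
    (hr : 𝓔.IsBoundedSetoid r) :
    ∃ s, 𝓔.IsBoundedSetoid s ∧ r ≤ s ∧ ∀ x, l ≤ classCount r s x := by
  obtain ⟨ε, hε, hrε⟩ := id hr
  obtain ⟨δ, hδ, hle⟩ := hκ l hl ε hε
  obtain ⟨s, hs, hδs⟩ := hcell.exists_isBoundedSetoid hδ
  refine ⟨r ⊔ s, hcell.isBoundedSetoid_sup hr hs, le_sup_left, fun x => (hle x).trans ?_⟩
  refine (cov_le_mk_quotient_image hrε _).trans (Cardinal.mk_le_mk_of_subset
    (Set.image_mono fun y hy => (le_sup_right : s ≤ r ⊔ s) (hδs x y hy)))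

/-- The coarse structure has a well-ordered family of setoids as a base which is so short that
families of bounded setoids indexed by proper initial segments are bounded. -/
theorem exists_short_base {𝓔 : Ballean X} (hcell : 𝓔.IsCellular) (hord : 𝓔.IsOrdinal) :
    ∃ (o : Ordinal.{u}) (B : Set.Iio o → Setoid X), (∀ i, 𝓔.IsBoundedSetoid (B i)) ∧
      (∀ ε ∈ 𝓔.radii, ∃ i, ∀ x y, (x, y) ∈ ε → B i x y) ∧
      ∀ (i : Set.Iio o) (F : Set.Iio o → Setoid X), (∀ j < i, 𝓔.IsBoundedSetoid (F j)) →
        ∃ s, 𝓔.IsBoundedSetoid s ∧ ∀ j < i, F j ≤ s := by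
  obtain ⟨κ, D, hmono, hrad, hsub, hbase⟩ := hord
  have hDrad : ∀ a, D a ∈ 𝓔.radii := fun a => hrad ⟨a, rfl⟩
  have hDcof : ∀ ε ∈ 𝓔.radii, ∃ a, ε ⊆ D a := by
    intro ε hε
    obtain ⟨_, ⟨a, rfl⟩, ha⟩ := hbase ε ⟨𝓔.isEntourage ε hε, ε, hε, subset_rfl⟩
    exact ⟨a, ha⟩
  -- The least length of a cofinal map into the base index is used: by minimality, no shorter family
  -- of indices is cofinal, so it has a strict upper bound.
  let S : Set Ordinal.{u} := {o | ∃ f : Set.Iio o → Set.Iio κ, ∀ a, ∃ i, a ≤ f i}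
  have hS : sInf S ∈ S := csInf_mem ⟨κ, id, fun a => ⟨a, le_rfl⟩⟩
  obtain ⟨f, hf⟩ := id hS
  choose B hB hDB using fun a => hcell.exists_isBoundedSetoid (hDrad a)
  refine ⟨sInf S, fun i => B (f i), fun i => hB _, fun ε hε => ?_, fun i F hF => ?_⟩
  · obtain ⟨a, ha⟩ := hDcof ε hε
    obtain ⟨i, hi⟩ := hf a
    exact ⟨i, fun x y h => hDB _ x y (hmono hi (ha h))⟩
  · let u : Set.Iio (i : Ordinal.{u}) → Set.Iio (sInf S) := fun j =>
      ⟨j, (Set.mem_Iio.1 j.2).trans (Set.mem_Iio.1 i.2)⟩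
    have hg : ∀ j, ∃ a, ∀ x y, F (u j) x y → (x, y) ∈ D a := by
      intro j
      obtain ⟨η, hη, h⟩ := hF (u j) j.2
      obtain ⟨a, ha⟩ := hDcof η hη
      exact ⟨a, fun x y hxy => ha (h x y hxy)⟩
    choose g hg using hg
    have hi : (i : Ordinal.{u}) ∉ S := fun h => not_le.2 i.2 (csInf_le' h)
    have hi' : ∃ a, ∀ j, g j < a := by
      by_contra! hcon
      exact hi ⟨g, hcon⟩
    obtain ⟨a, ha⟩ := hi'
    exact ⟨B a, hB a, fun j hj x y h => hDB a x y (hmono (ha ⟨j, hj⟩).le (hg ⟨j, hj⟩ x y h))⟩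

/-! ### The tower when the covering number is uncountable. -/

/-- Each `E₂`-class consists of at least `μ` classes of `E₁`, and an infinite set of size at least
`μ` is a disjoint union of groups of size exactly `μ`. Each group has between `μ` and `μ * μ = μ`
classes of `P`. -/
theorem exists_setoid_classCount_eq {P E₁ E₂ : Setoid X} {μ : Cardinal.{u}}
    (hμ : Cardinal.aleph0 ≤ μ) (hPE₁ : P ≤ E₁) (hE : E₁ ≤ E₂) (h₁ : ∀ x, classCount P E₁ x ≤ μ)
    (h₂ : ∀ x, μ ≤ classCount E₁ E₂ x) :
    ∃ E, E₁ ≤ E ∧ E ≤ E₂ ∧ ∀ x, classCount P E x = μ := by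
  classical
  let d : Quotient E₁ → Quotient E₂ := Quotient.map' id hE
  let A : Quotient E₂ → Set (Quotient E₁) := fun q => {a | d a = q}
  have hA : ∀ x, A (Quotient.mk E₂ x) = Quotient.mk E₁ '' {y | E₂ x y} := by
    intro x
    ext a
    induction a using Quotient.inductionOn with | _ y =>
    constructor
    · intro h
      exact ⟨y, E₂.symm (Quotient.exact h), rfl⟩
    · rintro ⟨z, hz, hzy⟩
      rw [← hzy]
      exact Quotient.sound (E₂.symm hz)
  have hequiv : ∀ q, Nonempty (A q ≃ A q × μ.out) := by
    intro q
    have hq : μ ≤ Cardinal.mk (A q) := by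
      induction q using Quotient.inductionOn with | _ x =>
      rw [hA]
      exact h₂ x
    rw [← Cardinal.eq, Cardinal.mk_prod, Cardinal.lift_id, Cardinal.lift_id, Cardinal.mk_out]
    exact (Cardinal.mul_eq_left (hμ.trans hq) hq (Cardinal.aleph0_pos.trans_le hμ).ne').symm
  -- The fibres of the first projection are the groups of size `μ`; `g` names the group by an
  -- element of the same `E₂`-class.
  let e : ∀ q, A q ≃ A q × μ.out := fun q => (hequiv q).some
  let g : Quotient E₁ → Quotient E₁ := fun a => (e (d a) ⟨a, rfl⟩).1
  have hg : ∀ q a (ha : d a = q), g a = (e q ⟨a, ha⟩).1 := by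
    rintro q a rfl
    rfl
  have hdg : ∀ a, d (g a) = d a := fun a => (e (d a) ⟨a, rfl⟩).1.2
  refine ⟨Setoid.ker (g ∘ Quotient.mk E₁), fun x y h => ?_, fun x y h => ?_, fun x => ?_⟩
  · exact congrArg g (Quotient.sound h)
  · have h' : g (Quotient.mk E₁ x) = g (Quotient.mk E₁ y) := h
    have h'' := congrArg d h'
    rw [hdg, hdg] at h''
    exact Quotient.exact h''
  · set S : Set X := {y | Setoid.ker (g ∘ Quotient.mk E₁) x y}
    have hT : Cardinal.mk (Quotient.mk E₁ '' S) = μ := by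
      let z : A (d (Quotient.mk E₁ x)) := ⟨g (Quotient.mk E₁ x), hdg _⟩
      let m : μ.out → Quotient E₁ := fun t => (e _).symm (z, t)
      have hm : Function.Injective m := fun t t' h =>
        (Prod.ext_iff.1 ((e _).symm.injective (Subtype.ext h))).2
      have hr : Quotient.mk E₁ '' S = Set.range m := by
        ext a
        constructor
        · rintro ⟨y, hy, rfl⟩
          have hy : g (Quotient.mk E₁ x) = g (Quotient.mk E₁ y) := hy
          have hd : d (Quotient.mk E₁ y) = d (Quotient.mk E₁ x) := by
            rw [← hdg, ← hy, hdg]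
          refine ⟨(e _ ⟨_, hd⟩).2, ?_⟩
          have : (z, (e _ ⟨_, hd⟩).2) = e _ ⟨_, hd⟩ :=
            Prod.ext (Subtype.ext (hy.trans (hg _ _ hd))) rfl
          simp only [m]
          rw [this, Equiv.symm_apply_apply]
        · rintro ⟨t, rfl⟩
          obtain ⟨y, hy⟩ := Quotient.exists_rep (m t)
          refine ⟨y, ?_, hy⟩
          change g (Quotient.mk E₁ x) = g (Quotient.mk E₁ y)
          rw [hy, hg _ (m t) ((e _).symm (z, t)).2]
          simp [m, z]
      rw [hr, Cardinal.mk_range_eq m hm, Cardinal.mk_out]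
    refine le_antisymm ?_ (hT.ge.trans (mk_quotient_image_le hPE₁ S))
    have hsub : Quotient.mk P '' S ⊆
        ⋃ a : (Quotient.mk E₁ '' S : Set _), Quotient.mk P '' {y | E₁ a.1.out y} := by
      rintro _ ⟨y, hy, rfl⟩
      exact Set.mem_iUnion.2 ⟨⟨Quotient.mk E₁ y, y, hy, rfl⟩, y, Quotient.mk_out (s := E₁) y, rfl⟩
    calc Cardinal.mk (Quotient.mk P '' S) ≤ _ := Cardinal.mk_le_mk_of_subset hsub
      _ ≤ _ := Cardinal.mk_iUnion_le _
      _ ≤ μ * μ := mul_le_mul' hT.le (ciSup_le' fun a => h₁ _)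
      _ = μ := Cardinal.mul_eq_self hμ

theorem isHomogeneous_of_aleph0_lt [Nonempty X] {𝓔 : Ballean X} (hcell : 𝓔.IsCellular)
    (hord : 𝓔.IsOrdinal) {κ : Cardinal.{u}} (hκ : Cardinal.aleph0 < κ)
    (hsharp : 𝓔.IsSharpBound κ) (hflat : 𝓔.IsFlatBound κ) : 𝓔.IsHomogeneous := by
  obtain ⟨o, B, hB, hcof, hinit⟩ := exists_short_base hcell hord
  obtain ⟨s₀, hs₀, hlt⟩ := exists_setoid_sharp hcell hsharp
  -- The hypotheses on `P` sit inside the existential so that the step is a total function usable in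
  -- transfinite recursion; boundedness of the stages is proved afterwards in `hbdd`.
  have hstep : ∀ (i : Set.Iio o) (P : Setoid X), ∃ E : Setoid X, 𝓔.IsBoundedSetoid P → s₀ ≤ P →
      𝓔.IsBoundedSetoid E ∧ P ≤ E ∧ B i ≤ E ∧ ∃ c, ∀ x, classCount P E x = c := by
    intro i P
    by_cases hP : 𝓔.IsBoundedSetoid P ∧ s₀ ≤ P
    · have hPB := hcell.isBoundedSetoid_sup hP.1 (hB i)
      obtain ⟨μ, hμ, hle⟩ := hlt _ hPB
      obtain ⟨E₂, hE₂, hle₂, hcount⟩ := exists_setoid_flat hcell hflat (max_lt hμ hκ) hPB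
      obtain ⟨E, h₁, h₂, hc⟩ := exists_setoid_classCount_eq (le_max_right μ _) le_sup_left hle₂
        (fun x => ((classCount_anti hP.2 _ x).trans (hle x)).trans (le_max_left _ _)) hcount
      exact ⟨E, fun _ _ => ⟨hE₂.of_le h₂, le_sup_left.trans h₁, le_sup_right.trans h₁, _, hc⟩⟩
    · exact ⟨P, fun h₁ h₂ => absurd ⟨h₁, h₂⟩ hP⟩
  choose step hstep using hstep
  let E : Set.Iio o → Setoid X :=
    WellFoundedLT.fix fun i rec => step i (s₀ ⊔ ⨆ j, ⨆ h : j < i, rec j h)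
  have hE : ∀ i, E i = step i (s₀ ⊔ ⨆ j < i, E j) := fun i => WellFoundedLT.fix_eq _ i
  have hbdd : ∀ i, 𝓔.IsBoundedSetoid (s₀ ⊔ ⨆ j < i, E j) := by
    intro i
    induction i using WellFoundedLT.induction with | _ i ih =>
    obtain ⟨s, hs, hle⟩ := hinit i E fun j hj => by
      rw [hE]
      exact (hstep j _ (ih j hj) le_sup_left).1
    exact (hcell.isBoundedSetoid_sup hs₀ hs).of_le (sup_le_sup_left (iSup₂_le hle) _)
  have hspec : ∀ i, 𝓔.IsBoundedSetoid (E i) ∧ (s₀ ⊔ ⨆ j < i, E j) ≤ E i ∧ B i ≤ E i ∧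
      ∃ c, ∀ x, classCount (s₀ ⊔ ⨆ j < i, E j) (E i) x = c := by
    intro i
    have := hstep i _ (hbdd i) le_sup_left
    rwa [← hE] at this
  refine isHomogeneous_of_tower 𝓔 (E₀ := s₀) (E := E) ?_ (fun i => le_sup_left.trans (hspec i).2.1)
    (fun i => (hspec i).1) (fun ε hε => ?_) fun i => (hspec i).2.2.2
  · intro i j hij
    rcases hij.eq_or_lt with rfl | h
    · exact le_rfl
    · exact ((le_iSup₂ (f := fun k (_ : k < j) => E k) i h).trans le_sup_right).trans
        (hspec j).2.1
  · obtain ⟨i, hi⟩ := hcof ε hε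
    exact ⟨i, fun x y h => (hspec i).2.2.1 (hi x y h)⟩

end Ballean

/-! ### Finite combinatorics: blocks of prescribed weight. -/

/-- In a smallest admissible set, deleting any element outside `s` drops the weight below `τ`, and a
deletion costs at most `b`. -/
theorem Finset.exists_subset_sum_between {I : Type*} [DecidableEq I] {s t : Finset I} (hst : s ⊆ t)
    {l : I → ℕ} {b τ : ℕ} (hl : ∀ i, l i ≤ b) (hs : ∑ i ∈ s, l i < τ + b)
    (ht : τ ≤ ∑ i ∈ t, l i) :
    ∃ u, s ⊆ u ∧ u ⊆ t ∧ τ ≤ ∑ i ∈ u, l i ∧ ∑ i ∈ u, l i < τ + b := by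
  obtain ⟨u, hu, hmin⟩ := (t.powerset.filter fun u => s ⊆ u ∧ τ ≤ ∑ i ∈ u, l i).exists_min_image
    Finset.card ⟨t, by simp [hst, ht]⟩
  simp only [Finset.mem_filter, Finset.mem_powerset] at hu hmin
  refine ⟨u, hu.2.1, hu.1, hu.2.2, ?_⟩
  by_contra! hge
  obtain ⟨i, hi, his⟩ : ∃ i ∈ u, i ∉ s := by
    by_contra! hcon
    rw [Finset.Subset.antisymm hcon hu.2.1] at hge
    omega
  have hsum := Finset.add_sum_erase u l hi
  have hli := hl i
  have := hmin (u.erase i) ⟨(u.erase_subset i).trans hu.1,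
    fun a ha => Finset.mem_erase.2 ⟨fun h => his (h ▸ ha), hu.2.1 ha⟩, by omega⟩
  have := Finset.card_erase_lt_of_mem hi
  omega

/-- Blocks are differences of an increasing chain of subsets whose weights exceed the thresholds `τ
k` by less than `b`. Errors do not accumulate, because each cut is measured against its own
threshold. -/
theorem Finset.exists_blocks_aux {I : Type*} [DecidableEq I] {t : Finset I} {l : I → ℕ} {b : ℕ}
    (hb : 0 < b) (hl : ∀ i, l i ≤ b) {τ : ℕ → ℕ} (hτ : Monotone τ) (hτ₀ : τ 0 = 0) {j : ℕ}
    (hτj : τ j ≤ ∑ i ∈ t, l i) :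
    ∃ (β : I → ℕ) (u : Finset I), u ⊆ t ∧ τ j ≤ ∑ i ∈ u, l i ∧ ∑ i ∈ u, l i < τ j + b ∧
      (∀ i ∈ u, β i < j) ∧ ∀ k < j, τ (k + 1) < τ k + b + ∑ i ∈ u with β i = k, l i ∧
        ∑ i ∈ u with β i = k, l i + τ k < τ (k + 1) + b := by
  induction j with
  | zero => exact ⟨fun _ => 0, ∅, by simp, by simp [hτ₀], by simp [hb], by simp, by simp⟩
  | succ j ih =>
    obtain ⟨β, u, hut, h₁, h₂, hβ, hsum⟩ := ih ((hτ (Nat.le_add_right j 1)).trans hτj)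
    obtain ⟨v, huv, hvt, h₃, h₄⟩ := Finset.exists_subset_sum_between hut hl
      (h₂.trans_le (Nat.add_le_add_right (hτ (Nat.le_add_right j 1)) b)) hτj
    refine ⟨fun i => if i ∈ u then β i else j, v, hvt, h₃, h₄, fun i _ => ?_, fun k hk => ?_⟩
    · dsimp only
      split_ifs with h
      · exact (hβ i h).trans j.lt_succ_self
      · exact j.lt_succ_self
    · rcases (Nat.lt_succ_iff.1 hk).eq_or_lt with rfl | hkj
      · have hfil : (v.filter fun i => (if i ∈ u then β i else k) = k) = v \ u := by
          ext i
          simp only [Finset.mem_filter, Finset.mem_sdiff]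
          refine and_congr_right fun _ => ⟨fun h hi => ?_, fun h => if_neg h⟩
          rw [if_pos hi] at h
          exact (hβ i hi).ne h
        rw [hfil]
        have := Finset.sum_sdiff (f := l) huv
        omega
      · have hfil : (v.filter fun i => (if i ∈ u then β i else j) = k) = u.filter (β · = k) := by
          ext i
          simp only [Finset.mem_filter]
          constructor
          · rintro ⟨-, h⟩
            split_ifs at h with hi
            · exact ⟨hi, h⟩
            · omega
          · rintro ⟨hi, h⟩
            exact ⟨huv hi, by rwa [if_pos hi]⟩
        rw [hfil]
        exact hsum k hkj

/-- A finite set with weights in `[1, b]` can be split into `j` blocks of nearly equal weight. -/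
theorem Finset.exists_blocks {I : Type*} [DecidableEq I] (t : Finset I) {l : I → ℕ} {b : ℕ}
    (hl₁ : ∀ i, 1 ≤ l i) (hl : ∀ i, l i ≤ b) (hb : 0 < b) {j : ℕ} (hj : 0 < j) :
    ∃ β : I → ℕ, (∀ i ∈ t, β i < j) ∧ ∀ k < j,
      (∑ i ∈ t, l i) / j < ∑ i ∈ t with β i = k, l i + b ∧
        ∑ i ∈ t with β i = k, l i ≤ (∑ i ∈ t, l i) / j + b := by
  set Λ := ∑ i ∈ t, l i
  have hτj : j * Λ / j = Λ := Nat.mul_div_cancel_left Λ hj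
  obtain ⟨β, u, hut, h₁, -, hβ, hsum⟩ := Finset.exists_blocks_aux (t := t) hb hl
    (τ := fun n => n * Λ / j) (fun m n h => Nat.div_le_div_right (Nat.mul_le_mul_right Λ h))
    (by simp) (j := j) hτj.le
  have hu : u = t := by
    by_contra hne
    obtain ⟨i, hit, hiu⟩ := Finset.exists_of_ssubset (hut.ssubset_of_ne hne)
    have := Finset.sum_lt_sum_of_subset hut hit hiu (hl₁ i) (fun _ _ _ => Nat.zero_le _)
    rw [hτj] at h₁
    omega
  subst hu
  refine ⟨β, hβ, fun k hk => ?_⟩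
  have hk' := hsum k hk
  rw [Nat.succ_mul] at hk'
  have h₂ : k * Λ / j + Λ / j ≤ (k * Λ + Λ) / j := Nat.div_add_div_le_add_div
  have h₃ : (k * Λ + Λ) / j ≤ k * Λ / j + Λ / j + 1 := by
    rw [Nat.add_div hj]
    split_ifs <;> omega
  omega

/-- If each element of a large finite set may have weight `l i` or `l i + 1`, then there are
numbers `L` and `k` such that the weights can be selected so that the set is a union of `L` blocks
of weight exactly `k`, as well as of `L + 1` such blocks. -/
theorem Finset.exists_exact_blocks {b : ℕ} (hb : 0 < b) :
    ∃ k N : ℕ, 0 < k ∧ ∀ {I : Type u} [DecidableEq I] (t : Finset I) (l : I → ℕ),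
      (∀ i, 1 ≤ l i) → (∀ i, l i ≤ b) → N ≤ t.card → ∃ L, 1 ≤ L ∧ L ≤ ∑ i ∈ t, l i ∧
        ∀ e ≤ 1, ∀ i₀, ∃ flag β : I → ℕ, (∀ i, flag i ≤ 1) ∧ flag i₀ = 0 ∧
          (∀ i ∈ t, β i < L + e) ∧
            ∀ m < L + e, ∑ i ∈ t with β i = m, (l i + flag i) = k := by
  -- With `A = b * (4 * b + 1)`, the target weight is `k = A + 3 * b`, and `N = A * (4 * b + 2)`
  -- ensures `L ≥ 4 * b + 1`. Then `L` or `L + 1` blocks have average weight between `A` and `A + 2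
  -- * b`, hence every block weighs more than `A - b` and at most `k`.
  refine ⟨(b + 1) * (4 * b), b * (4 * b + 1) * (4 * b + 2), by positivity, ?_⟩
  intro I _ t l hl₁ hl hcard
  set A := b * (4 * b + 1) with hA
  set Λ := ∑ i ∈ t, l i with hΛ
  have hA0 : 0 < A := by positivity
  have hcardΛ : t.card ≤ Λ := by
    rw [Finset.card_eq_sum_ones]
    exact Finset.sum_le_sum fun i _ => hl₁ i
  have hq : 4 * b + 2 ≤ Λ / A := (Nat.le_div_iff_mul_le hA0).2 (by
    rw [mul_comm]
    exact hcard.trans hcardΛ)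
  obtain ⟨L, hL⟩ : ∃ L, Λ / A = L + 1 := ⟨Λ / A - 1, by omega⟩
  have hlow : (L + 1) * A ≤ Λ := by
    rw [← hL]
    exact Nat.div_mul_le_self Λ A
  have hupp : Λ < (L + 2) * A := by
    have := Nat.lt_div_mul_add (a := Λ) hA0
    rw [hL] at this
    linarith
  refine ⟨L, by omega, (Nat.le_succ L).trans ((Nat.le_mul_of_pos_right _ hA0).trans hlow),
    fun e he i₀ => ?_⟩
  have hj : 0 < L + e := by omega
  have hq₁ : A ≤ Λ / (L + e) := (Nat.le_div_iff_mul_le hj).2 (by nlinarith)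
  have hq₂ : Λ / (L + e) ≤ A + 2 * b := by
    refine Nat.le_of_lt_succ ((Nat.div_lt_iff_lt_mul hj).2 (hupp.trans_le ?_))
    have h1 : 4 * b + 1 ≤ L := by omega
    have h2 : b * (4 * b + 1) ≤ b * L := Nat.mul_le_mul_left b h1
    calc (L + 2) * A = L * A + 2 * A := by ring
      _ ≤ L * A + 2 * (b * L) := by omega
      _ ≤ (A + 2 * b).succ * (L + e) := by
        rw [Nat.succ_eq_add_one]
        nlinarith
  obtain ⟨β, hβ, hsum⟩ := t.exists_blocks hl₁ hl hb hj
  -- The deficit of each block is filled by raising that many elements by one, never `i₀`.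
  have hflag : ∀ m < L + e, ∃ s ⊆ (t.filter (β · = m)).erase i₀,
      s.card = (b + 1) * (4 * b) - ∑ i ∈ t with β i = m, l i := by
    intro m hm
    obtain ⟨h₁, h₂⟩ := hsum m hm
    rw [← hΛ] at h₁ h₂
    refine Finset.exists_subset_card_eq ?_
    have h₃ : ∑ i ∈ t with β i = m, l i ≤ (t.filter (β · = m)).card * b :=
      Finset.sum_le_card_nsmul _ _ _ fun i _ => hl i
    have h₄ := Finset.pred_card_le_card_erase (s := t.filter (β · = m)) (a := i₀)
    set lam := ∑ i ∈ t with β i = m, l i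
    set g := (t.filter (β · = m)).card
    have h₅ : A + 1 ≤ lam + b := by omega
    -- Since `b * g ≥ lam > A - b = 4 * b ^ 2`, one gets `b * (lam + g) ≥ (b + 1) * lam > b * k`;
    -- the block has enough elements even without `i₀`.
    have h₆ : (b + 1) * (4 * b) + 1 ≤ lam + g := by
      by_contra! hcon
      have h7 : b * (lam + g) ≤ b * ((b + 1) * (4 * b)) := Nat.mul_le_mul_left b (by omega)
      nlinarith
    omega
  choose! s hs hscard using hflag
  refine ⟨fun i => if i ∈ s (β i) ∧ β i < L + e then 1 else 0, β, fun i => ?_, ?_, hβ,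
    fun m hm => ?_⟩
  · dsimp only
    split_ifs <;> omega
  · refine if_neg fun h => ?_
    exact (Finset.mem_erase.1 (hs _ h.2 h.1)).1 rfl
  · have h₁ : ∑ i ∈ t with β i = m, (if i ∈ s (β i) ∧ β i < L + e then 1 else 0) =
        (s m).card := by
      rw [← Finset.sum_filter, Finset.sum_const, smul_eq_mul, mul_one]
      congr 1
      ext i
      simp only [Finset.mem_filter]
      constructor
      · rintro ⟨⟨-, rfl⟩, h, -⟩
        exact h
      · intro h
        have h' := Finset.mem_filter.1 (Finset.mem_of_mem_erase (hs m hm h))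
        refine ⟨h', ?_⟩
        rw [h'.2]
        exact ⟨h, hm⟩
    rw [Finset.sum_add_distrib, h₁, hscard m hm]
    have h₂ := (hsum m hm).2
    rw [← hΛ] at h₂
    have h₃ : A + 3 * b = (b + 1) * (4 * b) := by
      rw [hA]
      ring
    omega

/-! ### The tower when the covering number is countable. -/

namespace Ballean
variable {X : Type u}

/-- In a well-ordered base an unbounded sequence is cofinal. A bound of all `B j` with `j ≤ k`
cannot dominate every `r n`, so the indices chosen for the `r n` reach `k`. -/
theorem IsCellular.exists_isBoundedSetoid_cofinal_seq {𝓔 : Ballean X} (hcell : 𝓔.IsCellular)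
    (hord : 𝓔.IsOrdinal) {r : ℕ → Setoid X} (hr : ∀ n, 𝓔.IsBoundedSetoid (r n))
    (hunb : ∀ s, 𝓔.IsBoundedSetoid s → ∃ n, ¬ r n ≤ s) :
    ∃ B : ℕ → Setoid X, (∀ n, 𝓔.IsBoundedSetoid (B n)) ∧
      ∀ ε ∈ 𝓔.radii, ∃ n, ∀ x y, (x, y) ∈ ε → B n x y := by
  obtain ⟨o, B, hB, hcof, hinit⟩ := exists_short_base hcell hord
  have hidx : ∀ n, ∃ i, r n ≤ B i := by
    intro n
    obtain ⟨η, hη, h⟩ := hr n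
    obtain ⟨i, hi⟩ := hcof η hη
    exact ⟨i, fun {x y} hxy => hi x y (h x y hxy)⟩
  choose i hi using hidx
  have hsup : ∀ k, ∃ s, 𝓔.IsBoundedSetoid s ∧ ∀ j ≤ k, B j ≤ s := by
    intro k
    obtain ⟨s, hs, hle⟩ := hinit k B fun j _ => hB j
    refine ⟨s ⊔ B k, hcell.isBoundedSetoid_sup hs (hB k), fun j hj => ?_⟩
    rcases hj.eq_or_lt with rfl | h
    · exact le_sup_right
    · exact (hle j h).trans le_sup_left
  choose s hs hle using hsup
  refine ⟨fun n => s (i n), fun n => hs _, fun ε hε => ?_⟩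
  obtain ⟨k, hk⟩ := hcof ε hε
  obtain ⟨n, hn⟩ := hunb (s k) (hs k)
  have hkn : k ≤ i n := by
    by_contra! hlt
    exact hn ((hi n).trans (hle k _ hlt.le))
  exact ⟨n, fun x y h => hle _ k hkn (hk x y h)⟩

theorem succ_le_classCount {s₀ r s : Setoid X} (h₀ : s₀ ≤ r) (hrs : r ≤ s) {x : X} {n : ℕ}
    (hn : (n : Cardinal) ≤ classCount s₀ r x) (h₂ : 2 ≤ classCount r s x) :
    ((n + 1 : ℕ) : Cardinal) ≤ classCount s₀ s x := by
  obtain ⟨y, hy, hxy⟩ : ∃ y, s x y ∧ ¬ r x y := by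
    by_contra! hcon
    have hsub : Quotient.mk r '' {y | s x y} ⊆ {Quotient.mk r x} := by
      rintro _ ⟨y, hy, rfl⟩
      exact Quotient.sound (r.symm (hcon y hy))
    have h := h₂.trans (Cardinal.mk_le_mk_of_subset hsub)
    rw [Cardinal.mk_singleton] at h
    exact absurd h (by norm_num)
  have hnot : Quotient.mk s₀ y ∉ Quotient.mk s₀ '' {y | r x y} := by
    rintro ⟨z, hz, hzy⟩
    exact hxy (r.trans hz (h₀ (Quotient.exact hzy)))
  have hsub : insert (Quotient.mk s₀ y) (Quotient.mk s₀ '' {y | r x y}) ⊆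
      Quotient.mk s₀ '' {y | s x y} :=
    Set.insert_subset ⟨y, hy, rfl⟩ (Set.image_mono fun z hz => hrs hz)
  calc ((n + 1 : ℕ) : Cardinal) = n + 1 := by push_cast; rfl
    _ ≤ classCount s₀ r x + 1 := by gcongr
    _ = Cardinal.mk (insert (Quotient.mk s₀ y) (Quotient.mk s₀ '' {y | r x y}) : Set _) :=
        (Cardinal.mk_insert hnot).symm
    _ ≤ _ := Cardinal.mk_le_mk_of_subset hsub

theorem exists_natCast_le_classCount {𝓔 : Ballean X} (hcell : 𝓔.IsCellular) {κ : Cardinal.{u}}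
    (hflat : 𝓔.IsFlatBound κ) (hκ : 2 < κ) {s₀ : Setoid X} (hs₀ : 𝓔.IsBoundedSetoid s₀) (n : ℕ) :
    ∃ s, 𝓔.IsBoundedSetoid s ∧ s₀ ≤ s ∧ ∀ x, (n : Cardinal) ≤ classCount s₀ s x := by
  induction n with
  | zero => exact ⟨s₀, hs₀, le_rfl, fun x => by simp⟩
  | succ n ih =>
    obtain ⟨r, hr, h₀, hn⟩ := ih
    obtain ⟨s, hs, hrs, h₂⟩ := exists_setoid_flat hcell hflat hκ hr
    exact ⟨s, hs, h₀.trans hrs, fun x => succ_le_classCount h₀ hrs (hn x) (h₂ x)⟩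

/-- A setoid with a natural number assigned to each of its classes. -/
structure LabelledSetoid (X : Type u) where
  rel : Setoid X
  label : Quotient rel → ℕ

/-- If the classes of `S.rel` may be split into `S.label` or `S.label + 1` parts, then the classes
of `T.rel` can be split into `T.label` or `T.label + 1` unions of classes of `S.rel`, each of which
contains the same number of parts. -/
def LabelledSetoid.Extends (S T : LabelledSetoid X) : Prop :=
  ∃ hle : S.rel ≤ T.rel, ∃ k : ℕ, 0 < k ∧
    ∃ hfin : ∀ D : Quotient T.rel, {q : Quotient S.rel | Quotient.map' id hle q = D}.Finite,
      ∀ (D : Quotient T.rel), ∀ e ≤ 1, ∀ q₀, ∃ flag β : Quotient S.rel → ℕ,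
        (∀ q, flag q ≤ 1) ∧ flag q₀ = 0 ∧
        (∀ q, Quotient.map' id hle q = D → β q < T.label D + e) ∧
        ∀ m < T.label D + e,
          ∑ q ∈ (hfin D).toFinset.filter (β · = m), (S.label q + flag q) = k

theorem setOf_map'_eq {r s : Setoid X} (hle : r ≤ s) (x : X) :
    {q : Quotient r | Quotient.map' id hle q = Quotient.mk s x} =
      Quotient.mk r '' {y | s x y} := by
  ext q
  induction q using Quotient.inductionOn with | _ y =>
  constructor
  · intro h
    exact ⟨y, s.symm (Quotient.exact h), rfl⟩
  · rintro ⟨z, hz, hzy⟩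
    rw [← hzy]
    exact Quotient.sound (s.symm hz)

/-- Flatness makes the new classes contain at least `N` old ones, as the block lemma needs;
sharpness keeps their number, and with it the new labels, uniformly bounded so that the construction
can be repeated. -/
theorem LabelledSetoid.exists_extends {𝓔 : Ballean X} (hcell : 𝓔.IsCellular)
    (hflat : 𝓔.IsFlatBound Cardinal.aleph0) {s₀ : Setoid X}
    (hfin : ∀ s, 𝓔.IsBoundedSetoid s → ∃ M : ℕ, ∀ x, classCount s₀ s x ≤ M)
    (S : LabelledSetoid X) (hS : 𝓔.IsBoundedSetoid S.rel) (h₀ : s₀ ≤ S.rel)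
    (hpos : ∀ q, 1 ≤ S.label q) (hbd : ∃ b, ∀ q, S.label q ≤ b)
    {R : Setoid X} (hR : 𝓔.IsBoundedSetoid R) :
    ∃ T : LabelledSetoid X, 𝓔.IsBoundedSetoid T.rel ∧ R ≤ T.rel ∧ S.Extends T ∧
      (∀ q, 1 ≤ T.label q) ∧ ∃ b, ∀ q, T.label q ≤ b := by
  classical
  obtain ⟨b, hb⟩ := hbd
  obtain ⟨k, N, hk, hblock⟩ := Finset.exists_exact_blocks.{u} (b := b + 1) b.succ_pos
  have hSR := hcell.isBoundedSetoid_sup hS hR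
  obtain ⟨s, hs, hle, hN⟩ :=
    exists_setoid_flat hcell hflat (Cardinal.natCast_lt_aleph0 (n := N)) hSR
  have hrs : S.rel ≤ s := le_sup_left.trans hle
  obtain ⟨M, hM⟩ := hfin s hs
  have hM' : ∀ x, classCount S.rel s x ≤ M := fun x => (classCount_anti h₀ s x).trans (hM x)
  have hN' : ∀ x, (N : Cardinal) ≤ classCount S.rel s x := fun x =>
    (hN x).trans (classCount_anti le_sup_left s x)
  have hfinite : ∀ D : Quotient s, {q : Quotient S.rel | Quotient.map' id hrs q = D}.Finite := by
    intro D
    induction D using Quotient.inductionOn with | _ x =>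
    rw [setOf_map'_eq hrs x, ← Cardinal.lt_aleph0_iff_set_finite]
    exact (hM' x).trans_lt Cardinal.natCast_lt_aleph0
  have hcard : ∀ D : Quotient s, N ≤ (hfinite D).toFinset.card ∧
      (hfinite D).toFinset.card ≤ M := by
    intro D
    have h : ((hfinite D).toFinset.card : Cardinal) =
        Cardinal.mk {q : Quotient S.rel | Quotient.map' id hrs q = D} := by
      rw [← Cardinal.mk_coe_finset]
      exact Cardinal.mk_congr (Equiv.subtypeEquivRight fun q => Set.Finite.mem_toFinset _)
    rw [← Nat.cast_le (α := Cardinal.{u}), ← Nat.cast_le (α := Cardinal.{u}), h]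
    induction D using Quotient.inductionOn with | _ x =>
    rw [setOf_map'_eq hrs x]
    exact ⟨hN' x, hM' x⟩
  choose L hL₁ hL₂ hL using fun D => hblock (hfinite D).toFinset S.label hpos
    (fun q => (hb q).trans b.le_succ) (hcard D).1
  refine ⟨⟨s, L⟩, hs, le_sup_right.trans hle, ⟨hrs, k, hk, hfinite, fun D e he q₀ => ?_⟩, hL₁,
    M * b, fun D => ?_⟩
  · obtain ⟨flag, β, h₁, h₂, h₃, h₄⟩ := hL D e he q₀
    exact ⟨flag, β, h₁, h₂, fun q hq => h₃ q ((Set.Finite.mem_toFinset _).2 hq), h₄⟩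
  · calc L D ≤ _ := hL₂ D
      _ ≤ (hfinite D).toFinset.card * b := Finset.sum_le_card_nsmul _ _ _ fun q _ => hb q
      _ ≤ M * b := Nat.mul_le_mul_right b (hcard D).2

/-- A descending recursion without a starting point: if the value `0` on the class of `x₀` always
passes to the class of `x₀`, then values in all quotients can be chosen consistently. -/
theorem exists_consistent_flags {E : ℕ → Setoid X} (hE : ∀ n, E n ≤ E (n + 1)) (x₀ : X)
    (hcover : ∀ x, ∃ n, E n x x₀) (step : ∀ n, Quotient (E (n + 1)) → ℕ → Quotient (E n) → ℕ)
    (hstep : ∀ n D e q, e ≤ 1 → step n D e q ≤ 1)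
    (hspine : ∀ n, step n (Quotient.mk _ x₀) 0 (Quotient.mk _ x₀) = 0) :
    ∃ e : ∀ n, Quotient (E n) → ℕ, (∀ n q, e n q ≤ 1) ∧
      ∀ n q, e n q =
        step n (Quotient.map' id (hE n) q) (e (n + 1) (Quotient.map' id (hE n) q)) q := by
  have hmono : Monotone E := monotone_nat_of_le_succ hE
  let par : ∀ n, Quotient (E n) → Quotient (E (n + 1)) := fun n => Quotient.map' id (hE n)
  -- `G d n` starts from the value `0` at level `n + d` and descends `d` levels. Once a class lies
  -- under that of `x₀` at level `n + d`, starting higher changes nothing, because `0` is reproduced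
  -- along the classes of `x₀`; the values are therefore eventually constant in `d`.
  let G : ℕ → ∀ n, Quotient (E n) → ℕ := fun d =>
    Nat.rec (fun _ _ => 0) (fun _ G n q => step n (par n q) (G (n + 1) (par n q)) q) d
  have hG : ∀ d n q, G (d + 1) n q = step n (par n q) (G d (n + 1) (par n q)) q :=
    fun d n q => rfl
  have hG₁ : ∀ d n q, G d n q ≤ 1 := by
    intro d
    induction d with
    | zero => exact fun n q => Nat.zero_le 1
    | succ d ih => exact fun n q => hstep _ _ _ _ (ih _ _)
  have hstable : ∀ d n x, E (n + d) x x₀ →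
      G (d + 1) n (Quotient.mk _ x) = G d n (Quotient.mk _ x) := by
    intro d
    induction d with
    | zero =>
      intro n x hx
      have : Quotient.mk (E n) x = Quotient.mk _ x₀ := Quotient.sound hx
      rw [this]
      exact hspine n
    | succ d ih =>
      intro n x hx
      rw [hG (d + 1), hG d]
      congr 1
      refine ih (n + 1) x ?_
      rwa [add_assoc, add_comm 1 d]
  have hstable' : ∀ d d' n x, E (n + d) x x₀ → d ≤ d' →
      G d' n (Quotient.mk _ x) = G d n (Quotient.mk _ x) := by
    intro d d' n x hx hdd
    induction d', hdd using Nat.le_induction with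
    | base => rfl
    | succ d' hdd ih => rw [hstable d' n x (hmono (by omega) hx), ih]
  have hlim : ∀ n q, ∃ d, ∀ d' ≥ d, G d' n q = G d n q := by
    intro n q
    induction q using Quotient.inductionOn with | _ x =>
    obtain ⟨d, hd⟩ := hcover x
    exact ⟨d, fun d' hd' => hstable' d d' n x (hmono (by omega) hd) hd'⟩
  choose d hd using hlim
  refine ⟨fun n q => G (d n q) n q, fun n q => hG₁ _ _ _, fun n q => ?_⟩
  have h₁ := hd n q (max (d n q) (d (n + 1) (par n q)) + 1)
    ((le_max_left _ _).trans (Nat.le_succ _))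
  have h₂ := hd (n + 1) (par n q) (max (d n q) (d (n + 1) (par n q))) (le_max_right _ _)
  dsimp only
  rw [← h₁, hG, h₂]

/-- The relation `F n` cuts the classes of `S n` into the chosen blocks, so it is interleaved with
the `S n`. A class of `F (n + 1)` is one block, and its total weight `k n` is exactly its number of
`F n`-classes. -/
theorem exists_regular_seq (S : ℕ → LabelledSetoid X) (hext : ∀ n, (S n).Extends (S (n + 1)))
    (x₀ : X) (hcover : ∀ x, ∃ n, (S n).rel x x₀) (hlabel : ∀ q, (S 0).label q = 1) (g : X → ℕ)
    (hg : ∀ x, g '' {y | (S 0).rel x y} = Set.Iio 2) :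
    ∃ F : ℕ → Setoid X, (∀ n, F n ≤ (S n).rel) ∧ (∀ n, (S n).rel ≤ F (n + 1)) ∧
      ∀ n, ∃ c, ∀ x, classCount (F n) (F (n + 1)) x = c := by
  classical
  choose hle k hk hfin hflag using hext
  have hflag' : ∀ n (D : Quotient (S (n + 1)).rel) e, ∃ flag β : Quotient (S n).rel → ℕ, e ≤ 1 →
      (∀ q, flag q ≤ 1) ∧ flag (Quotient.mk _ x₀) = 0 ∧
      (∀ q, Quotient.map' id (hle n) q = D → β q < (S (n + 1)).label D + e) ∧
      ∀ m < (S (n + 1)).label D + e,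
        ∑ q ∈ (hfin n D).toFinset.filter (β · = m), ((S n).label q + flag q) = k n := by
    intro n D e
    by_cases he : e ≤ 1
    · obtain ⟨flag, β, h⟩ := hflag n D e he (Quotient.mk _ x₀)
      exact ⟨flag, β, fun _ => h⟩
    · exact ⟨0, 0, fun h => absurd h he⟩
  choose flag β hβ using hflag'
  obtain ⟨e, he₁, he⟩ := exists_consistent_flags hle x₀ hcover flag
    (fun n D e q h => (hβ n D e h).1 q) fun n => (hβ n _ 0 zero_le_one).2.1
  let b : ∀ n, Quotient (S n).rel → ℕ := fun n q =>
    β n (Quotient.map' id (hle n) q) (e (n + 1) (Quotient.map' id (hle n) q)) q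
  -- At level 0, where all labels are 1, a class stays whole if its flag is 0 and is cut in two by
  -- `g` if its flag is 1; at higher levels `γ` is the block index.
  let γ : ℕ → X → ℕ := fun n =>
    Nat.casesOn n (fun x => e 0 (Quotient.mk _ x) * g x) fun n x => b n (Quotient.mk _ x)
  have hb : ∀ n q, b n q < (S (n + 1)).label (Quotient.map' id (hle n) q) +
      e (n + 1) (Quotient.map' id (hle n) q) := fun n q => (hβ n _ _ (he₁ _ _)).2.2.1 q rfl
  have hsum : ∀ n D, ∀ m < (S (n + 1)).label D + e (n + 1) D,
      ∑ q ∈ (hfin n D).toFinset.filter (b n · = m), ((S n).label q + e n q) = k n := by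
    intro n D m hm
    rw [← (hβ n D _ (he₁ _ _)).2.2.2 m hm]
    have hD : ∀ q ∈ (hfin n D).toFinset, Quotient.map' id (hle n) q = D := fun q hq =>
      (hfin n D).mem_toFinset.1 hq
    refine Finset.sum_congr (Finset.filter_congr fun q hq => ?_) fun q hq => ?_
    · simp only [b]
      rw [hD q hq]
    · rw [he n q, hD q (Finset.mem_filter.1 hq).1]
  -- Every permitted index occurs, so a class has exactly `label + e` parts; a block cannot be empty
  -- because its weight is `k n > 0`.
  have hγ : ∀ n q m, (∃ y, Quotient.mk (S n).rel y = q ∧ γ n y = m) ↔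
      m < (S n).label q + e n q := by
    intro n q m
    cases n with
    | zero =>
      induction q using Quotient.inductionOn with | _ x =>
      have hgm : ∀ m, (∃ y, (S 0).rel x y ∧ g y = m) ↔ m < 2 := fun m =>
        Set.ext_iff.1 (hg x) m
      rw [hlabel]
      have h01 : ∀ y, Quotient.mk (S 0).rel y = Quotient.mk _ x ↔ (S 0).rel x y := fun y =>
        ⟨fun h => (S 0).rel.symm (Quotient.exact h), fun h => Quotient.sound ((S 0).rel.symm h)⟩
      have hγ₀ : ∀ y, γ 0 y = e 0 (Quotient.mk _ y) * g y := fun y => rfl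
      constructor
      · rintro ⟨y, hy, rfl⟩
        rw [hγ₀, hy]
        have := (hgm (g y)).1 ⟨y, (h01 y).1 hy, rfl⟩
        have := he₁ 0 (Quotient.mk _ x)
        interval_cases e 0 (Quotient.mk _ x) <;> omega
      · intro hm
        have := he₁ 0 (Quotient.mk _ x)
        obtain ⟨y, hy, hym⟩ := (hgm m).2 (by omega)
        refine ⟨y, (h01 y).2 hy, ?_⟩
        rw [hγ₀, (h01 y).2 hy, hym]
        interval_cases e 0 (Quotient.mk _ x) <;> omega
    | succ n =>
      constructor
      · rintro ⟨y, rfl, rfl⟩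
        exact hb n (Quotient.mk _ y)
      · intro hm
        have hne : ((hfin n q).toFinset.filter (b n · = m)).Nonempty := by
          rw [Finset.nonempty_iff_ne_empty]
          intro h
          have := hsum n q m hm
          rw [h, Finset.sum_empty] at this
          exact (hk n).ne this
        obtain ⟨p, hp⟩ := hne
        obtain ⟨y, rfl⟩ := Quotient.exists_rep p
        obtain ⟨hy, hym⟩ := Finset.mem_filter.1 hp
        exact ⟨y, (hfin n q).mem_toFinset.1 hy, hym⟩
  let f : ∀ n, X → Σ _ : Quotient (S n).rel, ℕ := fun n x => ⟨Quotient.mk _ x, γ n x⟩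
  have hf : ∀ n x y, f n x = f n y ↔ (S n).rel x y ∧ γ n x = γ n y := by
    intro n x y
    simp only [f, Sigma.mk.injEq, heq_eq_eq]
    exact and_congr_left fun _ => Quotient.eq
  refine ⟨fun n => Setoid.ker (f n), fun n x y h => ((hf n x y).1 h).1, fun n x y h => ?_,
    fun n => ⟨k n, fun x => ?_⟩⟩
  · refine (hf (n + 1) x y).2 ⟨hle n h, ?_⟩
    exact congrArg (b n) (Quotient.sound h)
  -- The `F n`-classes in the block of `x` are the pairs of an `S n`-class in that block and one of
  -- its parts.
  · have himage : f n '' {y | Setoid.ker (f (n + 1)) x y} =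
        (((hfin n (Quotient.mk _ x)).toFinset.filter (b n · = γ (n + 1) x)).sigma
          fun q => Finset.range ((S n).label q + e n q) :
          Finset (Σ _ : Quotient (S n).rel, ℕ)) := by
      ext ⟨q, m⟩
      rw [Finset.mem_coe, Finset.mem_sigma, Finset.mem_filter, Finset.mem_range,
        Set.Finite.mem_toFinset, ← hγ n q m]
      constructor
      · rintro ⟨y, hy, hyq⟩
        obtain ⟨hxy, hγxy⟩ := (hf (n + 1) x y).1 hy
        simp only [f, Sigma.mk.injEq, heq_eq_eq] at hyq
        obtain ⟨rfl, rfl⟩ := hyq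
        exact ⟨⟨Quotient.sound ((S (n + 1)).rel.symm hxy), hγxy.symm⟩, y, rfl, rfl⟩
      · rintro ⟨⟨h₁, h₂⟩, y, rfl, rfl⟩
        exact ⟨y, (hf (n + 1) x y).2 ⟨(S (n + 1)).rel.symm (Quotient.exact h₁), h₂.symm⟩, rfl⟩
    rw [classCount, mk_quotient_image_ker, himage]
    refine Cardinal.mk_coe_finset.trans ?_
    rw [Finset.card_sigma, Nat.cast_inj]
    simp only [Finset.card_range]
    exact hsum n _ _ ((hγ (n + 1) _ _).1 ⟨x, rfl, rfl⟩)

theorem exists_splitting {s₀ s : Setoid X} (h₂ : ∀ x, 2 ≤ classCount s₀ s x) :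
    ∃ g : X → ℕ, ∀ x, g '' {y | s x y} = Set.Iio 2 := by
  classical
  let o : X → X := fun x => (Quotient.mk s x).out
  have ho : ∀ x, s (o x) x := fun x => Quotient.mk_out (s := s) x
  have hoo : ∀ x y, s x y → o x = o y := fun x y h => congrArg Quotient.out (Quotient.sound h)
  refine ⟨fun x => if s₀ (o x) x then 0 else 1, fun x => ?_⟩
  ext m
  rw [Set.mem_Iio]
  constructor
  · rintro ⟨y, -, rfl⟩
    dsimp only
    split_ifs <;> omega
  · intro hm
    interval_cases m
    · refine ⟨o x, s.symm (ho x), if_pos ?_⟩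
      rw [hoo _ _ (ho x)]
    · by_contra hcon
      have hsub : Quotient.mk s₀ '' {y | s x y} ⊆ {Quotient.mk s₀ (o x)} := by
        rintro _ ⟨y, hy, rfl⟩
        refine Quotient.sound (s₀.symm ?_)
        by_contra hn
        refine hcon ⟨y, hy, if_neg ?_⟩
        rwa [← hoo x y hy]
      have h := (h₂ x).trans (Cardinal.mk_le_mk_of_subset hsub)
      rw [Cardinal.mk_singleton] at h
      exact absurd h (by norm_num)

theorem isHomogeneous_of_eq_aleph0 [Nonempty X] {𝓔 : Ballean X} (hcell : 𝓔.IsCellular)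
    (hord : 𝓔.IsOrdinal) (hsharp : 𝓔.IsSharpBound Cardinal.aleph0)
    (hflat : 𝓔.IsFlatBound Cardinal.aleph0) : 𝓔.IsHomogeneous := by
  obtain ⟨x₀⟩ := id ‹Nonempty X›
  obtain ⟨s₀, hs₀, hlt⟩ := exists_setoid_sharp hcell hsharp
  have hfin : ∀ s, 𝓔.IsBoundedSetoid s → ∃ M : ℕ, ∀ x, classCount s₀ s x ≤ M := by
    intro s hs
    obtain ⟨μ, hμ, hle⟩ := hlt s hs
    obtain ⟨M, rfl⟩ := Cardinal.lt_aleph0.1 hμ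
    exact ⟨M, hle⟩
  choose r hr _ hcount using fun n : ℕ =>
    exists_setoid_flat hcell hflat (Cardinal.natCast_lt_aleph0 (n := n)) hs₀
  -- The relations `r n` have classes with at least `n` pieces, whereas a bounded relation has
  -- uniformly finitely many; hence they are unbounded and a countable base exists.
  obtain ⟨B, hB, hcof⟩ := hcell.exists_isBoundedSetoid_cofinal_seq hord hr fun s hs => by
    obtain ⟨M, hM⟩ := hfin s hs
    refine ⟨M + 1, fun hle => ?_⟩
    have h := ((hcount (M + 1) x₀).trans (classCount_mono s₀ hle x₀)).trans (hM x₀)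
    rw [Nat.cast_le] at h
    omega
  obtain ⟨s₁, hs₁, hs₀₁, h₂⟩ := exists_setoid_flat hcell hflat (l := 2)
    (by exact_mod_cast Cardinal.natCast_lt_aleph0 (n := 2)) hs₀
  obtain ⟨g, hg⟩ := exists_splitting h₂
  let Good : LabelledSetoid X → Prop := fun S => 𝓔.IsBoundedSetoid S.rel ∧ s₀ ≤ S.rel ∧
    (∀ q, 1 ≤ S.label q) ∧ ∃ b, ∀ q, S.label q ≤ b
  have hstep : ∀ (n : ℕ) (S : {S // Good S}), ∃ T : {S // Good S}, B n ≤ T.1.rel ∧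
      S.1.Extends T.1 := by
    rintro n ⟨S, hS, h₀, hpos, hbd⟩
    obtain ⟨T, hT, hBT, hext, hT₁, hT₂⟩ := S.exists_extends hcell hflat hfin hS h₀ hpos hbd (hB n)
    exact ⟨⟨T, hT, h₀.trans hext.1, hT₁, hT₂⟩, hBT, hext⟩
  choose next hnext using hstep
  let S : ℕ → {S // Good S} := fun n =>
    Nat.rec ⟨⟨s₁, fun _ => 1⟩, hs₁, hs₀₁, fun _ => le_rfl, 1, fun _ => le_rfl⟩ next n
  have hS : ∀ n, B n ≤ (S (n + 1)).1.rel ∧ (S n).1.Extends (S (n + 1)).1 := fun n => hnext n (S n)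
  have hcof' : ∀ ε ∈ 𝓔.radii, ∃ n, ∀ x y, (x, y) ∈ ε → (S n).1.rel x y := by
    intro ε hε
    obtain ⟨n, hn⟩ := hcof ε hε
    exact ⟨n + 1, fun x y h => (hS n).1 (hn x y h)⟩
  obtain ⟨F, hF₁, hF₂, hF₃⟩ := exists_regular_seq (fun n => (S n).1) (fun n => (hS n).2) x₀
    (fun x => by
      have hx : (x, x₀) ∈ ⋃₀ 𝓔.radii := by rw [𝓔.sUnion_radii]; trivial
      obtain ⟨ε, hε, h⟩ := hx
      obtain ⟨n, hn⟩ := hcof' ε hε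
      exact ⟨n, hn x x₀ h⟩) (fun _ => rfl) g hg
  have hmono : Monotone F := monotone_nat_of_le_succ fun n => (hF₁ n).trans (hF₂ n)
  refine isHomogeneous_of_tower 𝓔 (E₀ := F 0) (E := fun n => F (n + 1))
    (fun m n h => hmono (Nat.succ_le_succ h)) (fun n => hmono (Nat.zero_le _))
    (fun n => (S (n + 1)).2.1.of_le (hF₁ _)) (fun ε hε => ?_) fun n => ?_
  · obtain ⟨n, hn⟩ := hcof' ε hε
    exact ⟨n, fun x y h => hF₂ n (hn x y h)⟩
  · have hP : F 0 ⊔ ⨆ j < n, F (j + 1) = F n := by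
      refine le_antisymm (sup_le (hmono n.zero_le) (iSup₂_le fun j hj => hmono hj)) ?_
      cases n with
      | zero => exact le_sup_left
      | succ n =>
        exact (le_iSup₂ (f := fun j (_ : j < n + 1) => F (j + 1)) n n.lt_succ_self).trans
          le_sup_right
    rw [hP]
    exact hF₃ n

/-! ### Small covering numbers and the case distinction. -/

/-- Every bounded class contains only one `s₀`-class, and any two points lie in a common bounded
class, so `s₀` relates all points. -/
theorem univ_mem_radii_of_isSharpBound_two [Nonempty X] {𝓔 : Ballean X} (hcell : 𝓔.IsCellular)
    (hsharp : 𝓔.IsSharpBound 2) : Set.univ ∈ 𝓔.radii := by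
  obtain ⟨s₀, ⟨η, hη, hs₀η⟩, hlt⟩ := exists_setoid_sharp hcell hsharp
  have hall : ∀ x y, s₀ x y := by
    intro x y
    have hxy : (x, y) ∈ ⋃₀ 𝓔.radii := by rw [𝓔.sUnion_radii]; trivial
    obtain ⟨ε, hε, h⟩ := hxy
    obtain ⟨s, hs, hεs⟩ := hcell.exists_isBoundedSetoid hε
    obtain ⟨μ, hμ, hle⟩ := hlt s hs
    have hone : classCount s₀ s x ≤ 1 := by
      obtain ⟨m, rfl⟩ := Cardinal.lt_aleph0.1 (hμ.trans Cardinal.ofNat_lt_aleph0)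
      refine (hle x).trans ?_
      have hm : m < 2 := by exact_mod_cast hμ
      exact_mod_cast Nat.le_of_lt_succ hm
    rw [classCount, Cardinal.mk_le_one_iff_set_subsingleton] at hone
    exact Quotient.exact (hone ⟨x, s.refl x, rfl⟩ ⟨y, hεs x y h, rfl⟩)
  have : η = Set.univ := Set.eq_univ_of_forall fun p => hs₀η p.1 p.2 (hall _ _)
  rwa [← this]

theorem isHomogeneous_of_covFlat_eq_covSharp [Nonempty X] {𝓔 : Ballean X} (hcell : 𝓔.IsCellular)
    (hord : 𝓔.IsOrdinal) (h : 𝓔.covFlat = 𝓔.covSharp) : 𝓔.IsHomogeneous := by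
  have hsharp : 𝓔.IsSharpBound 𝓔.covSharp := 𝓔.isLeast_covSharp.1
  have hflat : 𝓔.IsFlatBound 𝓔.covSharp := h ▸ 𝓔.isGreatest_covFlat.1
  rcases le_or_gt 𝓔.covSharp 2 with h₂ | h₂
  · refine isHomogeneous_of_univ_mem (univ_mem_radii_of_isSharpBound_two hcell ?_)
    obtain ⟨ε, hε, hlt⟩ := hsharp
    exact ⟨ε, hε, fun δ hδ => (hlt δ hδ).trans_le h₂⟩
  rcases lt_trichotomy 𝓔.covSharp Cardinal.aleph0 with hω | hω | hω
  -- For finite `κ = n > 2`, iterating the lower bound 2 yields a bounded relation with at least `n`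
  -- classes of `s₀` in each class, although sharpness allows fewer than `n`.
  · exfalso
    obtain ⟨s₀, hs₀, hlt⟩ := exists_setoid_sharp hcell hsharp
    obtain ⟨n, hn⟩ := Cardinal.lt_aleph0.1 hω
    obtain ⟨s, hs, -, hle⟩ := exists_natCast_le_classCount hcell hflat h₂ hs₀ n
    obtain ⟨μ, hμ, hle'⟩ := hlt s hs
    obtain ⟨x⟩ := ‹Nonempty X›
    rw [hn] at hμ
    exact absurd ((hle x).trans (hle' x)) (not_le.2 hμ)
  · rw [hω] at hsharp hflat
    exact isHomogeneous_of_eq_aleph0 hcell hord hsharp hflat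
  · exact isHomogeneous_of_aleph0_lt hcell hord hω hsharp hflat

end Ballean

theorem mainTheorem2 {X : Type*} [Nonempty X] (𝓔 : Ballean X)
    (hcell : 𝓔.IsCellular) (hord : 𝓔.IsOrdinal) :
    𝓔.IsHomogeneous ↔ 𝓔.covFlat = 𝓔.covSharp :=
  ⟨Ballean.IsHomogeneous.covFlat_eq_covSharp,
    Ballean.isHomogeneous_of_covFlat_eq_covSharp hcell hord⟩
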